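/- Let $\mathbb F\in\{\mathbb R,\mathbb C\}$, and let $\varphi_0,\varphi_1,\dots$ be the standard enumeration of the partial recursive functions $\mathbb N\rightharpoonup\mathbb N$. A (partial) numbering of elements of a set $X$ is a partial map $\nu:\mathbb N\rightharpoonup X$; if $\nu(e)=x$, then $e$ is called an index of $x$. A map $F:X\to Y$ is an effective operation from $\nu$ to a numbering $\nu'$ of elements of $Y$ if there is a partial recursive $\varphi$ such that, for every $e\in\operatorname{dom}\nu$, $\varphi(e)$ is defined and is a $\nu'$-index of $F(\nu(e))$. An index of a pair $(x,y)$ codes an index of $x$ and an index of $y$; an index of a computable sequence $(x_n)$ (double sequence $(x_{i,n})$) is an index of a recursive function that computes an index of $x_n$ from $n$ (of $x_{i,n}$ from $i,n$). An index of a computable real $r$ is an $e$ such that $\varphi_e$ is total and $|q_{\varphi_e(n)}-r|<2^{-n}$ for all $n$, where $(q_k)$ is a standard enumeration of $\mathbb Q$; an index of a computable scalar codes indices of its real and imaginary parts. A numbering $\nu$ of elements of a normed space $\mathfrak X$ over $\mathbb F$ makes $\mathfrak X$ effective if addition, multiplication by computable scalars, the norm (as an operation into the computable reals), and the limit of computable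 sequences $(x_n)$ with $\|x_n-\lim_k x_k\|<2^{-n}$ for all $n$, are effective operations with respect to $\nu$. Let $\mathfrak X$ be a Banach space over $\mathbb F$ with the approximation property: every compact operator on $\mathfrak X$ is the norm limit of a sequence of bounded operators of finite rank. Let $\nu$ be a numbering that makes $\mathfrak X$ effective and $\nu'$ a numbering that makes the dual $\mathfrak X^*$, with its dual norm, effective. For $x\in\mathfrak X$ and $y\in\mathfrak X^*$ let $x\odot y$ be the operator $z\mapsto y(z)x$. A bounded operator $T$ on $\mathfrak X$ is effectively compact if there are a computable double sequence $(x_{i,n})$ of vectors (with respect to $\nu$), a computable double sequence $(y_{i,n})$ of functionals (with respect to $\nu'$), and recursive functions $d,m:\mathbb N\to\mathbb N$ such that $$\Big\|\sum_{i<d(n)}x_{i,n}\odot y_{i,n}-T\Big\|<2^{-N}\qquad\text{for all } N \text{ and all } n\ge m(N);$$ an index of $T$ codes indices of $(x_{i,n})$, $(y_{i,n})$, $d$ and $m$. Then the operator norm $T\mapsto\|T\|$ is an effective operation from the effectively compact operators on $\mathfrak X$ to the computable reals: there is a partial recursive function that sends each index of each effectively compact operator $T$ to an index of the computable real $\|T\|$.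 -/

import Mathlib

open Filter Topology

/-- The standard enumeration `φ_0, φ_1, …` of the partial recursive functions `ℕ ⇀ ℕ`. -/
def phi (e : ℕ) : ℕ →. ℕ := (Denumerable.ofNat Nat.Partrec.Code e).eval

/-- A (partial) numbering of a subset of `X`: `IsIndex e x` says that `e` lies in the domain of
the numbering and that its value at `e` is `x`. -/
structure PartialNumbering (X : Type*) where
  IsIndex : ℕ → X → Prop
  unique : ∀ {e : ℕ} {x y : X}, IsIndex e x → IsIndex e y → x = y

namespace PartialNumbering

/-- The numbering of pairs: `⟨a, b⟩` is an index of `(x, y)` if `a` is one of `x` and `b` of `y`. -/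
def prod {X Y : Type*} (ν : PartialNumbering X) (ν' : PartialNumbering Y) : PartialNumbering (X × Y) where
  IsIndex e p := ν.IsIndex e.unpair.1 p.1 ∧ ν'.IsIndex e.unpair.2 p.2
  unique h h' := Prod.ext (ν.unique h.1 h'.1) (ν'.unique h.2 h'.2)

/-- The numbering of computable sequences: `e` is an index of `(x_n)` if `φ_e` is total and
`φ_e(n)` is an index of `x_n` for every `n`. -/
def seq {X : Type*} (ν : PartialNumbering X) : PartialNumbering (ℕ → X) where
  IsIndex e x := ∀ n, ∃ c ∈ phi e n, ν.IsIndex c (x n)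
  unique h h' := by
    funext n
    obtain ⟨c, hc, hx⟩ := h n
    obtain ⟨c', hc', hy⟩ := h' n
    obtain rfl := Part.mem_unique hc hc'
    exact ν.unique hx hy

/-- The numbering of computable double sequences: `e` is an index of `(x_{i,n})` if `φ_e` is total
and `φ_e(⟨i, n⟩)` is an index of `x_{i,n}` for all `i`, `n`. -/
def seq₂ {X : Type*} (ν : PartialNumbering X) : PartialNumbering (ℕ → ℕ → X) where
  IsIndex e x := ∀ i n, ∃ c ∈ phi e (Nat.pair i n), ν.IsIndex c (x i n)
  unique h h' := by
    funext i n
    obtain ⟨c, hc, hx⟩ := h i n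
    obtain ⟨c', hc', hy⟩ := h' i n
    obtain rfl := Part.mem_unique hc hc'
    exact ν.unique hx hy

end PartialNumbering

/-- `F` is an effective operation, from the elements numbered by `ν` to those numbered by `ν'`:
some partial recursive function sends each index of each `x` to an index of `F x`. -/
def EffectiveOp {X Y : Type*} (ν : PartialNumbering X) (ν' : PartialNumbering Y) (F : X → Y) : Prop :=
  ∃ φ : ℕ →. ℕ, Nat.Partrec φ ∧
    ∀ (e : ℕ) (x : X), ν.IsIndex e x → ∃ c ∈ φ e, ν'.IsIndex c (F x)

/-- A standard total numbering of the rationals: `⟨⟨a, b⟩, c⟩ ↦ (a - b) / (c + 1)`. -/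
def ratNumbering (n : ℕ) : ℚ :=
  ((n.unpair.1.unpair.1 : ℚ) - (n.unpair.1.unpair.2 : ℚ)) / ((n.unpair.2 : ℚ) + 1)

/-- `u` converges to `l` geometrically: `‖u_n - l‖ < 2⁻ⁿ` for all `n`. -/
def GeomConverges {X : Type*} [NormedAddCommGroup X] (u : ℕ → X) (l : X) : Prop :=
  ∀ n, ‖u n - l‖ < (2 : ℝ)⁻¹ ^ n

theorem tendsto_of_norm_sub_lt {X : Type*} [NormedAddCommGroup X] {u : ℕ → X} {l : X}
    {m : ℕ → ℕ} (h : ∀ N n, m N ≤ n → ‖u n - l‖ < (2 : ℝ)⁻¹ ^ N) : Tendsto u atTop (𝓝 l) := by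
  rw [Metric.tendsto_atTop]
  intro ε hε
  obtain ⟨N, hN⟩ := exists_pow_lt_of_lt_one hε (by norm_num : (2 : ℝ)⁻¹ < 1)
  exact ⟨m N, fun n hn => by rw [dist_eq_norm]; exact (h N n hn).trans hN⟩

theorem GeomConverges.tendsto {X : Type*} [NormedAddCommGroup X] {u : ℕ → X} {l : X}
    (h : GeomConverges u l) : Tendsto u atTop (𝓝 l) :=
  tendsto_of_norm_sub_lt (m := id) fun N n hn =>
    (h n).trans_le (pow_le_pow_of_le_one (by norm_num) (by norm_num) hn)

/-- The standard numbering of the computable reals: `e` is an index of `r` if `φ_e` is total and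
`|q_{φ_e(n)} - r| < 2⁻ⁿ` for all `n`, where `(q_k)` is the numbering of the rationals. -/
def realNumbering : PartialNumbering ℝ where
  IsIndex e r := ∃ f : ℕ → ℕ, (∀ n, f n ∈ phi e n) ∧
    GeomConverges (fun n => (ratNumbering (f n) : ℝ)) r
  unique := by
    rintro e r s ⟨f, hf, hr⟩ ⟨g, hg, hs⟩
    obtain rfl : f = g := funext fun n => Part.mem_unique (hf n) (hg n)
    exact tendsto_nhds_unique hr.tendsto hs.tendsto

/-- The standard numbering of the computable scalars (real or complex): `⟨a, b⟩` is an index of `z`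
if `a` is one of its real part and `b` is one of its imaginary part. -/
def scalarNumbering (𝕜 : Type*) [RCLike 𝕜] : PartialNumbering 𝕜 where
  IsIndex e z := realNumbering.IsIndex e.unpair.1 (RCLike.re z) ∧
    realNumbering.IsIndex e.unpair.2 (RCLike.im z)
  unique h h' := RCLike.ext (realNumbering.unique h.1 h'.1) (realNumbering.unique h.2 h'.2)

/-- The numbering `ν` makes the space `X` effective: addition, multiplication by computable scalars,
the norm, and effective limits (of geometrically convergent computable sequences) are
effective operations. -/
structure IsEffectiveSpace (𝕜 : Type*) [RCLike 𝕜] {X : Type*} [NormedAddCommGroup X]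
    [NormedSpace 𝕜 X] (ν : PartialNumbering X) : Prop where
  add : EffectiveOp (ν.prod ν) ν (fun p => p.1 + p.2)
  smul : EffectiveOp ((scalarNumbering 𝕜).prod ν) ν (fun p => p.1 • p.2)
  norm : EffectiveOp ν realNumbering (fun x => ‖x‖)
  lim : ∃ φ : ℕ →. ℕ, Nat.Partrec φ ∧ ∀ (e : ℕ) (u : ℕ → X) (l : X),
    ν.seq.IsIndex e u → GeomConverges u l → ∃ c ∈ φ e, ν.IsIndex c l

/-- The approximation property: every compact operator on `X` is a norm limit of a sequence of
operators of finite rank. -/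
def HasApproximationProperty (𝕜 : Type*) [RCLike 𝕜] (X : Type*) [NormedAddCommGroup X]
    [NormedSpace 𝕜 X] : Prop :=
  ∀ K : X →L[𝕜] X, IsCompactOperator K →
    ∃ F : ℕ → X →L[𝕜] X,
      (∀ n, FiniteDimensional 𝕜 (LinearMap.range (F n : X →ₗ[𝕜] X))) ∧
        Tendsto (fun n => ‖F n - K‖) atTop (𝓝 0)

/-- The operator `x ⊙ y : z ↦ y(z) x`, for a vector `x` and a functional `y`. -/
def odot {𝕜 : Type*} [RCLike 𝕜] {X : Type*} [NormedAddCommGroup X] [NormedSpace 𝕜 X]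
    (x : X) (y : StrongDual 𝕜 X) : X →L[𝕜] X :=
  y.smulRight x

/-- The numbering of the effectively compact operators on `X`, with respect to numberings `ν` of the
computable vectors and `ν'` of the computable functionals. An index `⟨a, ⟨b, ⟨c, k⟩⟩⟩` of `T`
consists of indices `a`, `b` of computable double sequences `(x_{i,n})`, `(y_{i,n})` and indices
`c`, `k` of recursive functions `d`, `m`, such that the operators `∑_{i < d(n)} x_{i,n} ⊙ y_{i,n}`
converge in norm to `T` as `n → ∞` with modulus of convergence `m`. -/
def effectivelyCompactNumbering {𝕜 : Type*} [RCLike 𝕜] {X : Type*} [NormedAddCommGroup X]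
    [NormedSpace 𝕜 X] (ν : PartialNumbering X) (ν' : PartialNumbering (StrongDual 𝕜 X)) :
    PartialNumbering (X →L[𝕜] X) where
  IsIndex e T :=
    ∃ (x : ℕ → ℕ → X) (y : ℕ → ℕ → StrongDual 𝕜 X) (d m : ℕ → ℕ),
      ν.seq₂.IsIndex e.unpair.1 x ∧
      ν'.seq₂.IsIndex e.unpair.2.unpair.1 y ∧
      (∀ n, d n ∈ phi e.unpair.2.unpair.2.unpair.1 n) ∧
      (∀ N, m N ∈ phi e.unpair.2.unpair.2.unpair.2 N) ∧
      ∀ N n, m N ≤ n →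
        ‖∑ i ∈ Finset.range (d n), odot (x i n) (y i n) - T‖ < (2 : ℝ)⁻¹ ^ N
  unique := by
    rintro e T S ⟨x, y, d, m, hx, hy, hd, -, hT⟩ ⟨x', y', d', m', hx', hy', hd', -, hS⟩
    obtain rfl := ν.seq₂.unique hx hx'
    obtain rfl := ν'.seq₂.unique hy hy'
    obtain rfl : d = d' := funext fun n => Part.mem_unique (hd n) (hd' n)
    exact tendsto_nhds_unique (tendsto_of_norm_sub_lt hT) (tendsto_of_norm_sub_lt hS)

/-! Norms of operators are 1-Lipschitz, so it suffices to compute, uniformly, the norm of T = ∑ x_i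
⊙ y_i. No dense computable sequence is available, so neither unit vectors nor functionals can be
enumerated; only norms of combinations of the x_i and of the y_i can be computed.

By duality ‖T‖ is the supremum of ‖∑ f(u_j) w_j‖ over real functionals f with ‖f‖ ≤ 1, where the u_j
are the x_i and I x_i, and the w_j are the y_i and -I y_i. Thus f matters only through the finite
real vector b = (f(u_j)). Helly's theorem says which b occur, up to a tolerance: those with c · b ≤
‖∑ c_j u_j‖ for all real c, again a condition on norms alone.

To make this finite, work with functionals of norm at most a large S. Then b and c may be rounded to
integer vectors in bounded boxes and norms need only be known within 2. `abs_gridMax_sub_le` shows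
that maximising ‖∑ b_j w_j‖ over the integer b that pass all tests gives S‖T‖ with an error
independent of S; dividing by S gives any precision. The maximum is a primitive recursive function
of two finite tables of approximate norms, which are partial recursive in the indices. -/

/-! ### Helly's moment theorem, with tolerance and with integer tests -/

/-- A finite moment problem with tolerance `δ`. -/
theorem exists_strongDual_near_of_sum_le {E ι : Type*} [NormedAddCommGroup E] [NormedSpace ℝ E]
    [Fintype ι] (u : ι → E) (b : ι → ℝ) {S δ : ℝ} (hS : 0 ≤ S) (hδ : 0 ≤ δ)
    (h : ∀ c : ι → ℝ, ∑ j, c j * b j ≤ S * ‖∑ j, c j • u j‖ + δ * ∑ j, |c j|) :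
    ∃ f : StrongDual ℝ E, ‖f‖ ≤ S ∧ ∀ j, |b j - f (u j)| ≤ δ := by
  classical
  -- Keeping c as a second coordinate makes c ↦ c · b well defined on the range even if the u_j are
  -- dependent. The extra factor absorbs the tolerance δ when Hahn–Banach is applied.
  let G : (ι → ℝ) →ₗ[ℝ] E × (ι → ℝ) := (Fintype.linearCombination ℝ u).prod LinearMap.id
  let dot : (ι → ℝ) →ₗ[ℝ] ℝ := Fintype.linearCombination ℝ b
  let F : E × (ι → ℝ) →ₗ.[ℝ] ℝ :=
    ⟨LinearMap.range G, (dot ∘ₗ LinearMap.snd ℝ E (ι → ℝ)) ∘ₗ (LinearMap.range G).subtype⟩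
  obtain ⟨g, hg, hgN⟩ := exists_extension_of_le_sublinear F
    (fun v => S * ‖v.1‖ + δ * ∑ j, |v.2 j|)
    (by
      intro c hc v
      simp only [Prod.smul_fst, Prod.smul_snd, norm_smul, Pi.smul_apply, smul_eq_mul, abs_mul,
        Real.norm_eq_abs, abs_of_pos hc, ← Finset.mul_sum]
      ring)
    (by
      intro v w
      have h1 := mul_le_mul_of_nonneg_left (norm_add_le v.1 w.1) hS
      have h2 : ∑ j, |v.2 j + w.2 j| ≤ ∑ j, |v.2 j| + ∑ j, |w.2 j| := by
        rw [← Finset.sum_add_distrib]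
        exact Finset.sum_le_sum fun j _ => abs_add_le _ _
      have h3 := mul_le_mul_of_nonneg_left h2 hδ
      simp only [Prod.fst_add, Prod.snd_add, Pi.add_apply]
      linarith)
    (by
      rintro ⟨_, c, rfl⟩
      simpa [F, G, dot, Fintype.linearCombination_apply] using h c)
  have hE : ∀ x, g (x, 0) ≤ S * ‖x‖ := fun x => by simpa using hgN (x, 0)
  have hR : ∀ c, g (0, c) ≤ δ * ∑ j, |c j| := fun c => by simpa using hgN (0, c)
  refine ⟨(g ∘ₗ LinearMap.inl ℝ E (ι → ℝ)).mkContinuous S fun x => ?_,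
    LinearMap.mkContinuous_norm_le _ hS _, fun j => ?_⟩
  · rw [Real.norm_eq_abs, abs_le]
    have h1 := hE x
    have h2 := hE (-x)
    have h3 : g (-x, 0) = -g (x, 0) := by rw [← map_neg]; simp
    rw [h3, norm_neg] at h2
    exact ⟨by simpa using by linarith, by simpa using h1⟩
  -- The extension g splits as f + r with f on E and r on the second factor, so b_j - f(u_j) =
  -- r(e_j), which is at most δ in absolute value.
  · have h1 : g (u j, Pi.single j 1) = b j := by
      have := hg ⟨G (Pi.single j 1), ⟨_, rfl⟩⟩
      simpa [F, G, dot, Fintype.linearCombination_apply, Pi.single_apply] using this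
    have h2 : g (0, Pi.single j 1) = b j - g (u j, 0) := by
      rw [← h1, ← map_sub]; simp
    have hs : ∀ s : ℝ, ∑ i, |(Pi.single j s : ι → ℝ) i| = |s| := fun s => by
      rw [Finset.sum_eq_single j] <;> simp +contextual
    have h3 := hR (Pi.single j 1)
    have h4 := hR (-Pi.single j 1)
    have h5 : g (0, -Pi.single j 1) = -g (0, Pi.single j 1) := by rw [← map_neg]; simp
    rw [h5] at h4
    simp only [Pi.neg_apply, abs_neg] at h4
    rw [hs, h2] at h3 h4
    simp only [LinearMap.mkContinuous_apply, LinearMap.comp_apply, LinearMap.inl_apply]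
    rw [abs_le]
    constructor <;> norm_num at h3 h4 <;> linarith

/-- Integer test vectors of bounded size suffice in the moment problem. -/
theorem exists_strongDual_near_of_int_sum_le {E ι : Type*} [NormedAddCommGroup E]
    [NormedSpace ℝ E] [Fintype ι] (u : ι → E) (b : ι → ℝ) {S Q R : ℝ} {L : ℕ} (hS : 0 ≤ S)
    (hL : 0 < L) (hR : ∑ j, ‖u j‖ ≤ R) (hb : ∀ j, |b j| ≤ Q)
    (hLS : S * (R + 4) + Fintype.card ι * Q ≤ L)
    (h : ∀ c : ι → ℤ, (∀ j, |c j| ≤ L) →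
      ∑ j, c j * b j ≤ S * (‖∑ j, c j • u j‖ + 4) + Fintype.card ι * L) :
    ∃ f : StrongDual ℝ E, ‖f‖ ≤ S ∧ ∀ j, |b j - f (u j)| ≤ Fintype.card ι + 1 := by
  have hL' : (0 : ℝ) < L := by exact_mod_cast hL
  refine exists_strongDual_near_of_sum_le u b hS (by positivity) fun c => ?_
  rcases isEmpty_or_nonempty ι with hι | hι
  · simp
  obtain ⟨j₀, hj₀⟩ := Finite.exists_max fun j => |c j|
  rcases eq_or_lt_of_le (abs_nonneg (c j₀)) with h0 | h0
  · have hc : c = 0 := funext fun j => abs_eq_zero.1 (le_antisymm (h0 ▸ hj₀ j) (abs_nonneg _))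
    simp [hc]
  -- The desired inequality is homogeneous in c, so c may be scaled to have maximal entry L.
  -- Rounding s c then costs at most S R + card ι * Q; with the 4 S from the test this is at most L
  -- ≤ ∑ |s c_j|, which turns the tolerance card ι into card ι + 1.
  set s : ℝ := L / |c j₀| with hs
  have hspos : 0 < s := by positivity
  have hsc : ∀ j, |s * c j| ≤ L := fun j => by
    rw [abs_mul, abs_of_pos hspos, hs, div_mul_eq_mul_div, div_le_iff₀ h0]
    exact mul_le_mul_of_nonneg_left (hj₀ j) hL'.le
  have hsum : (L : ℝ) ≤ ∑ j, |s * c j| := by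
    refine le_trans (le_of_eq ?_) (Finset.single_le_sum (f := fun j => |s * c j|)
      (fun j _ => abs_nonneg _) (Finset.mem_univ j₀))
    rw [abs_mul, abs_of_pos hspos, hs, div_mul_cancel₀ _ h0.ne']
  have hround : ∀ j, ∃ z : ℤ, |z| ≤ (L : ℤ) ∧ |(z : ℝ) - s * c j| ≤ 1 := fun j => by
    obtain ⟨h1, h2⟩ := abs_le.1 (hsc j)
    refine ⟨⌊s * c j⌋, abs_le.2 ⟨Int.le_floor.2 (by push_cast; exact h1), ?_⟩, ?_⟩
    · have : ((⌊s * c j⌋ : ℤ) : ℝ) ≤ ((L : ℤ) : ℝ) := (Int.floor_le _).trans (by simpa using h2)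
      exact_mod_cast this
    · rw [abs_le]
      constructor <;> linarith [Int.floor_le (s * c j), Int.lt_floor_add_one (s * c j)]
  choose z hz hzc using hround
  have key := h z hz
  have e1 : ∑ j, (s * c j) * b j ≤ ∑ j, (z j : ℝ) * b j + Fintype.card ι * Q := by
    have : ∑ j, ((s * c j) * b j - (z j : ℝ) * b j) ≤ ∑ _j : ι, Q :=
      Finset.sum_le_sum fun j _ => by
        rw [← sub_mul]
        refine (le_abs_self _).trans ?_
        rw [abs_mul, abs_sub_comm]
        exact (mul_le_of_le_one_left (abs_nonneg _) (hzc j)).trans (hb j)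
    rw [Finset.sum_sub_distrib] at this
    simp only [Finset.sum_const, Finset.card_univ, nsmul_eq_mul] at this
    linarith
  have e2 : ‖∑ j, z j • u j‖ ≤ ‖∑ j, (s * c j) • u j‖ + R := by
    have h1 : ∑ j, z j • u j = ∑ j, (s * c j) • u j + ∑ j, ((z j : ℝ) - s * c j) • u j := by
      rw [← Finset.sum_add_distrib]
      refine Finset.sum_congr rfl fun j _ => ?_
      rw [← add_smul, add_sub_cancel, Int.cast_smul_eq_zsmul]
    rw [h1]
    refine (norm_add_le _ _).trans (add_le_add_right ?_ _)
    refine (norm_sum_le _ _).trans (le_trans (Finset.sum_le_sum fun j _ => ?_) hR)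
    rw [norm_smul]
    exact mul_le_of_le_one_left (norm_nonneg _) (hzc j)
  have e3 : ∑ j, (s * c j) • u j = s • ∑ j, c j • u j := by
    simp [Finset.smul_sum, mul_smul]
  have e4 : ∑ j, (s * c j) * b j = s * ∑ j, c j * b j := by simp [Finset.mul_sum, mul_assoc]
  have e5 : ∑ j, |s * c j| = s * ∑ j, |c j| := by
    simp [Finset.mul_sum, abs_mul, abs_of_pos hspos]
  rw [e3, norm_smul, Real.norm_eq_abs, abs_of_pos hspos] at e2
  rw [e4] at e1
  rw [e5] at hsum
  refine le_of_mul_le_mul_left ?_ hspos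
  have e6 := mul_le_mul_of_nonneg_left e2 hS
  have e7 : (Fintype.card ι + 1 : ℝ) * L ≤ (Fintype.card ι + 1 : ℝ) * (s * ∑ j, |c j|) :=
    mul_le_mul_of_nonneg_left hsum (by positivity)
  calc s * ∑ j, c j * b j
      ≤ S * (s * ‖∑ j, c j • u j‖) + (Fintype.card ι + 1 : ℝ) * (s * ∑ j, |c j|) := by linarith
    _ = s * (S * ‖∑ j, c j • u j‖ + (Fintype.card ι + 1) * ∑ j, |c j|) := by ring

/-! ### Coding integer vectors by natural numbers -/

/-- The `j`-th of the integers in `[-L, L]` coded by the base `2 * L + 1` expansion of `t`. -/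
def gridCoord (L t j : ℕ) : ℤ := (t / (2 * L + 1) ^ j % (2 * L + 1) : ℕ) - (L : ℤ)

theorem abs_gridCoord_le (L t j : ℕ) : |gridCoord L t j| ≤ L := by
  have := Nat.mod_lt (t / (2 * L + 1) ^ j) (by omega : 2 * L + 1 > 0)
  rw [gridCoord, abs_le]
  omega

theorem exists_gridCoord_eq {L D : ℕ} (c : Fin D → ℤ) (hc : ∀ j, |c j| ≤ L) :
    ∃ t < (2 * L + 1) ^ D, ∀ j : Fin D, gridCoord L t j = c j := by
  have hc' : ∀ j, (c j + L).toNat < 2 * L + 1 := fun j => by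
    have := abs_le.1 (hc j); omega
  let t := finFunctionFinEquiv fun j => (⟨(c j + L).toNat, hc' j⟩ : Fin (2 * L + 1))
  refine ⟨t, t.2, fun j => ?_⟩
  have h : finFunctionFinEquiv.symm t j = ⟨(c j + L).toNat, hc' j⟩ := by
    simp [t]
  have h' := congrArg Fin.val h
  simp only [finFunctionFinEquiv_symm_apply_val] at h'
  rw [gridCoord, h']
  have := abs_le.1 (hc j)
  omega

/-! ### The norm of a finite-rank operator through real functionals -/

/-- The scalars `1, I, 1, I, …`. -/
def unitOrI (𝕜 : Type*) [RCLike 𝕜] (j : ℕ) : 𝕜 := if j % 2 = 0 then 1 else RCLike.I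

/-- The scalars `1, -I, 1, -I, …`. -/
def unitOrNegI (𝕜 : Type*) [RCLike 𝕜] (j : ℕ) : 𝕜 := if j % 2 = 0 then 1 else -RCLike.I

theorem sum_range_two_mul {M : Type*} [AddCommMonoid M] (f : ℕ → M) (d : ℕ) :
    ∑ j ∈ Finset.range (2 * d), f j = ∑ i ∈ Finset.range d, (f (2 * i) + f (2 * i + 1)) := by
  induction d with
  | zero => simp
  | succ d ih =>
    rw [Nat.mul_succ, Finset.sum_range_succ, Finset.sum_range_succ, ih, Finset.sum_range_succ,
      add_assoc]

section OperatorNorm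

variable {𝕜 : Type*} [RCLike 𝕜] {X : Type*} [NormedAddCommGroup X] [NormedSpace 𝕜 X]
  [NormedSpace ℝ X] [IsScalarTower ℝ 𝕜 X]

/-- The 𝕜-linear extension of f is z ↦ f(z) - I f(I z), so each g(x_i) y_i splits into f(x_i) y_i
and f(I x_i)(-I y_i). Over ℝ, I is 0 and the odd terms vanish. -/
theorem sum_real_functional_smul_eq (f : StrongDual ℝ X) (x : ℕ → X) (y : ℕ → StrongDual 𝕜 X)
    (d : ℕ) :
    ∑ j ∈ Finset.range (2 * d),
        f (unitOrI 𝕜 j • x (j / 2)) • (unitOrNegI 𝕜 j • y (j / 2)) =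
      (f.extendRCLike : StrongDual 𝕜 X).comp (∑ i ∈ Finset.range d, odot (x i) (y i)) := by
  ext z
  rw [sum_range_two_mul, ContinuousLinearMap.comp_apply, sum_apply,
    sum_apply, map_sum]
  refine Finset.sum_congr rfl fun i _ => ?_
  have h1 : (2 * i + 1) / 2 = i := by omega
  have h2 : (2 * i + 1) % 2 = 1 := by omega
  simp only [unitOrI, unitOrNegI, odot, Nat.mul_mod_right, h1, h2, one_smul, if_true,
    Nat.mul_div_cancel_left i (Nat.succ_pos 1), one_ne_zero, if_false,
    ContinuousLinearMap.smulRight_apply, add_apply,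
    smul_apply, map_smul, StrongDual.extendRCLike_apply, smul_eq_mul,
    RCLike.real_smul_eq_coe_mul]
  ring

theorem norm_sum_real_functional_smul_le (f : StrongDual ℝ X) (x : ℕ → X)
    (y : ℕ → StrongDual 𝕜 X) (d : ℕ) :
    ‖∑ j ∈ Finset.range (2 * d), f (unitOrI 𝕜 j • x (j / 2)) • (unitOrNegI 𝕜 j • y (j / 2))‖ ≤
      ‖f‖ * ‖∑ i ∈ Finset.range d, odot (x i) (y i)‖ := by
  rw [sum_real_functional_smul_eq, ← StrongDual.norm_extendRCLike (𝕜 := 𝕜) f]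
  exact ContinuousLinearMap.opNorm_comp_le _ _

/-- For each z a norming functional of T z is the extension of a real functional of the same norm,
hence ‖T z‖ ≤ M ‖z‖. -/
theorem norm_sum_odot_le (x : ℕ → X) (y : ℕ → StrongDual 𝕜 X) (d : ℕ) {M : ℝ}
    (h : ∀ f : StrongDual ℝ X, ‖f‖ ≤ 1 → ‖∑ j ∈ Finset.range (2 * d),
      f (unitOrI 𝕜 j • x (j / 2)) • (unitOrNegI 𝕜 j • y (j / 2))‖ ≤ M) :
    ‖∑ i ∈ Finset.range d, odot (x i) (y i)‖ ≤ M := by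
  have hM : 0 ≤ M := (norm_nonneg _).trans (h 0 (by simp))
  refine ContinuousLinearMap.opNorm_le_bound _ hM fun z => ?_
  obtain ⟨g, hg, hgz⟩ := exists_dual_vector'' 𝕜 ((∑ i ∈ Finset.range d, odot (x i) (y i)) z)
  obtain ⟨f, rfl⟩ := (StrongDual.extendRCLikeₗ (𝕜 := 𝕜) (F := X)).surjective g
  change ‖(f.extendRCLike : StrongDual 𝕜 X)‖ ≤ 1 at hg
  change (f.extendRCLike : StrongDual 𝕜 X) _ = _ at hgz
  have h1 := h f (by rwa [StrongDual.norm_extendRCLike] at hg)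
  rw [sum_real_functional_smul_eq] at h1
  have h2 := ContinuousLinearMap.le_of_opNorm_le _ h1 z
  rw [ContinuousLinearMap.comp_apply, hgz] at h2
  simpa using h2

end OperatorNorm

/-! ### The finite search and its error -/

/-- The code `t'` of an integer vector `b` passes all tests `c · b ≤ S * (A c + 2) + D * L`, where
`c` is an integer vector with entries in `[-L, L]`; sums are arranged to avoid subtraction. -/
def PassesTests (D L Q S : ℕ) (A : ℕ → ℕ) (t' : ℕ) : Prop :=
  ∀ t < (2 * L + 1) ^ D,
    ∑ j ∈ Finset.range D, ((t / (2 * L + 1) ^ j % (2 * L + 1)) *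
        (t' / (2 * Q + 1) ^ j % (2 * Q + 1)) + L * Q) ≤
      ∑ j ∈ Finset.range D, ((t / (2 * L + 1) ^ j % (2 * L + 1)) * Q +
        L * (t' / (2 * Q + 1) ^ j % (2 * Q + 1))) + (S * (A t + 2) + D * L)

instance (D L Q S : ℕ) (A : ℕ → ℕ) : DecidablePred (PassesTests D L Q S A) :=
  fun _ => inferInstanceAs (Decidable (∀ t < (2 * L + 1) ^ D, _ ≤ _))

/-- For digits a, b one has (a - L)(b - Q) = (ab + LQ) - (aQ + Lb); the subtracted terms sit on the
right of the natural number inequality. -/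
theorem passesTests_iff {D L Q S : ℕ} {A : ℕ → ℕ} {t' : ℕ} :
    PassesTests D L Q S A t' ↔ ∀ t < (2 * L + 1) ^ D,
      ∑ j : Fin D, (gridCoord L t j : ℝ) * gridCoord Q t' j ≤ S * (A t + 2) + D * L := by
  refine forall₂_congr fun t _ => ?_
  rw [← Finset.sum_range fun j => (gridCoord L t j : ℝ) * gridCoord Q t' j,
    ← Nat.cast_le (α := ℝ), ← sub_nonneg, ← sub_nonneg (b := ∑ j ∈ _, _ * _)]
  refine iff_of_eq (congrArg (0 ≤ ·) ?_)
  have : ∑ j ∈ Finset.range D, (gridCoord L t j : ℝ) * gridCoord Q t' j =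
      ∑ j ∈ Finset.range D, (((t / (2 * L + 1) ^ j % (2 * L + 1)) *
        (t' / (2 * Q + 1) ^ j % (2 * Q + 1)) + L * Q : ℕ) : ℝ) -
      ∑ j ∈ Finset.range D, (((t / (2 * L + 1) ^ j % (2 * L + 1)) * Q +
        L * (t' / (2 * Q + 1) ^ j % (2 * Q + 1)) : ℕ) : ℝ) := by
    rw [← Finset.sum_sub_distrib]
    refine Finset.sum_congr rfl fun j _ => ?_
    simp only [gridCoord, Int.cast_sub, Int.cast_natCast, Nat.cast_add, Nat.cast_mul]
    ring
  rw [this]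
  push_cast
  ring

/-- The largest approximate norm `B t'` of a vector whose code `t'` passes all tests. -/
def gridMax (D L Q S : ℕ) (A B : ℕ → ℕ) : ℕ :=
  (Finset.range ((2 * Q + 1) ^ D)).sup fun t' => if PassesTests D L Q S A t' then B t' else 0

/-- Upper bound: a passing b lies within D + 1 of the values of some f with ‖f‖ ≤ S, so ‖∑ b_j w_j‖
≤ S V + (D + 1) R. Lower bound: for ‖f‖ ≤ 1 the vector of floors of S f(u_j) passes, and rounding
loses at most R. The table B adds 2 in each case. -/
theorem abs_gridMax_sub_le {E F : Type*} [NormedAddCommGroup E] [NormedSpace ℝ E]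
    [NormedAddCommGroup F] [NormedSpace ℝ F] {D L Q S R : ℕ} {A B : ℕ → ℕ} {u : ℕ → E} {w : ℕ → F}
    {V : ℝ} (hQ : Q = S * R + 1) (hL : L = S * (R + 4) + D * Q + 1)
    (hu : ∑ j ∈ Finset.range D, ‖u j‖ ≤ R) (hw : ∑ j ∈ Finset.range D, ‖w j‖ ≤ R)
    (hA : ∀ t < (2 * L + 1) ^ D, |(A t : ℝ) - ‖∑ j ∈ Finset.range D, gridCoord L t j • u j‖| ≤ 2)
    (hB : ∀ t < (2 * Q + 1) ^ D, |(B t : ℝ) - ‖∑ j ∈ Finset.range D, gridCoord Q t j • w j‖| ≤ 2)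
    (hle : ∀ f : StrongDual ℝ E, ‖∑ j ∈ Finset.range D, f (u j) • w j‖ ≤ ‖f‖ * V)
    (hge : ∀ M : ℝ, (∀ f : StrongDual ℝ E, ‖f‖ ≤ 1 →
      ‖∑ j ∈ Finset.range D, f (u j) • w j‖ ≤ M) → V ≤ M) (hV : 0 ≤ V) (hS : 0 < S) :
    |(gridMax D L Q S A B : ℝ) - S * V| ≤ (D + 1) * R + 2 := by
  have hS' : (0 : ℝ) < S := by exact_mod_cast hS
  have hnear : ∀ (a b : ℕ → ℝ) (K : ℝ), 0 ≤ K → (∀ j < D, |a j - b j| ≤ K) →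
      ‖∑ j ∈ Finset.range D, a j • w j‖ ≤ ‖∑ j ∈ Finset.range D, b j • w j‖ + K * R := by
    intro a b K hK hab
    have h1 : ∑ j ∈ Finset.range D, a j • w j = ∑ j ∈ Finset.range D, b j • w j +
        ∑ j ∈ Finset.range D, (a j - b j) • w j := by
      rw [← Finset.sum_add_distrib]
      exact Finset.sum_congr rfl fun j _ => by rw [← add_smul, add_sub_cancel]
    rw [h1]
    refine (norm_add_le _ _).trans (add_le_add_right ?_ _)
    refine (norm_sum_le _ _).trans (le_trans ?_ (mul_le_mul_of_nonneg_left hw hK))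
    rw [Finset.mul_sum]
    refine Finset.sum_le_sum fun j hj => ?_
    rw [norm_smul]
    exact mul_le_mul_of_nonneg_right (hab j (Finset.mem_range.1 hj)) (norm_nonneg _)
  have hintw : ∀ t', ∑ j ∈ Finset.range D, gridCoord Q t' j • w j =
      ∑ j ∈ Finset.range D, (gridCoord Q t' j : ℝ) • w j := fun t' =>
    Finset.sum_congr rfl fun j _ => (Int.cast_smul_eq_zsmul ℝ _ _).symm
  have huR : ∀ j < D, ‖u j‖ ≤ R := fun j hj =>
    (Finset.single_le_sum (fun j _ => norm_nonneg (u j)) (Finset.mem_range.2 hj)).trans hu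
  have hDR : (R : ℝ) ≤ (D + 1) * R := by nlinarith [D.cast_nonneg (α := ℝ), R.cast_nonneg (α := ℝ)]
  rw [abs_sub_le_iff]
  constructor
  · obtain ⟨t', ht', he⟩ := Finset.exists_mem_eq_sup (Finset.range ((2 * Q + 1) ^ D))
      ⟨0, Finset.mem_range.2 (by positivity)⟩
      fun t' => if PassesTests D L Q S A t' then B t' else 0
    rw [gridMax, he]
    split_ifs with hp
    · rw [passesTests_iff] at hp
      obtain ⟨f, hf, hfu⟩ := exists_strongDual_near_of_int_sum_le (fun j : Fin D => u j)
        (fun j : Fin D => (gridCoord Q t' j : ℝ)) (S := S) (Q := Q) (R := R) (L := L) hS'.le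
        (by omega) (by rwa [← Finset.sum_range fun j => ‖u j‖])
        (fun j => by exact_mod_cast abs_gridCoord_le Q t' j)
        (by rw [Fintype.card_fin, hL]; push_cast; linarith) (fun c hc => by
          obtain ⟨t, ht, hct⟩ := exists_gridCoord_eq c hc
          have h1 := hp t ht
          have h2 := (abs_le.1 (hA t ht)).2
          rw [Finset.sum_range] at h2
          simp only [hct] at h1 h2
          rw [Fintype.card_fin]
          -- The slack 2 in the test and the error 2 of A together give the 4 of the integer moment
          -- problem.
          have := mul_le_mul_of_nonneg_left h2 hS'.le
          linarith)
      rw [Fintype.card_fin] at hfu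
      have h1 := (abs_le.1 (hB t' (Finset.mem_range.1 ht'))).2
      have h2 := hnear (fun j => (gridCoord Q t' j : ℝ)) (fun j => f (u j)) (D + 1)
        (by positivity) fun j hj => hfu ⟨j, hj⟩
      have h3 := (hle f).trans (mul_le_mul_of_nonneg_right hf hV)
      rw [hintw] at h1
      linarith
    · have : 0 ≤ S * V := by positivity
      have : (0 : ℝ) ≤ R := R.cast_nonneg
      push_cast
      linarith
  · suffices h : V ≤ (gridMax D L Q S A B + R + 2) / S by
      rw [le_div_iff₀ hS'] at h
      linarith
    refine hge _ fun f hf => ?_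
    rw [le_div_iff₀ hS']
    have hfl : ∀ j, |S * f (u j) - ⌊S * f (u j)⌋| ≤ 1 := fun j => by
      rw [abs_le]
      constructor <;> linarith [Int.floor_le (S * f (u j)), Int.lt_floor_add_one (S * f (u j))]
    obtain ⟨t', ht', hbt⟩ := exists_gridCoord_eq (L := Q) (fun j : Fin D => ⌊S * f (u j)⌋)
      (fun j => by
        have h1 : |f (u j)| ≤ R := (f.le_of_opNorm_le hf (u j)).trans
          (by rw [one_mul]; exact huR j j.2)
        have h2 : |S * f (u j)| ≤ S * R := by
          rw [abs_mul, abs_of_pos hS']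
          exact mul_le_mul_of_nonneg_left h1 hS'.le
        have h3 : (|⌊S * f (u j)⌋| : ℝ) ≤ (S * R + 1 : ℝ) := by
          have h4 := abs_sub_abs_le_abs_sub (⌊S * f (u j)⌋ : ℝ) (S * f (u j))
          have h5 := hfl j
          rw [abs_sub_comm] at h5
          linarith
        rw [hQ]
        exact_mod_cast h3)
    have hp : PassesTests D L Q S A t' := by
      rw [passesTests_iff]
      intro t ht
      -- Replacing S f(u_j) by its floor changes each term by at most L; this is the allowance D * L
      -- in the test.
      have h1 : ∑ j : Fin D, (gridCoord L t j : ℝ) * gridCoord Q t' j ≤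
          ∑ j : Fin D, ((gridCoord L t j : ℝ) * (S * f (u j)) + L) :=
        Finset.sum_le_sum fun j _ => by
          have h2 : (gridCoord L t j : ℝ) * (gridCoord Q t' j - S * f (u j)) ≤ L := by
            refine (le_abs_self _).trans ?_
            rw [abs_mul, hbt, abs_sub_comm]
            refine (mul_le_of_le_one_right (abs_nonneg _) (hfl j)).trans ?_
            exact_mod_cast abs_gridCoord_le L t j
          linarith
      have h3 : ∑ j : Fin D, (gridCoord L t j : ℝ) * (S * f (u j)) =
          S * f (∑ j ∈ Finset.range D, gridCoord L t j • u j) := by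
        rw [map_sum, Finset.sum_range, Finset.mul_sum]
        refine Finset.sum_congr rfl fun j _ => ?_
        rw [map_zsmul, zsmul_eq_mul]
        ring
      have h4 : f (∑ j ∈ Finset.range D, gridCoord L t j • u j) ≤ A t + 2 := by
        refine (le_abs_self _).trans ((f.le_of_opNorm_le hf _).trans ?_)
        linarith [(abs_le.1 (hA t ht)).1]
      rw [Finset.sum_add_distrib, h3] at h1
      simp only [Finset.sum_const, Finset.card_univ, Fintype.card_fin, nsmul_eq_mul] at h1
      linarith [mul_le_mul_of_nonneg_left h4 hS'.le]
    have hB' : B t' ≤ gridMax D L Q S A B := by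
      have := Finset.le_sup (f := fun t' => if PassesTests D L Q S A t' then B t' else 0)
        (Finset.mem_range.2 ht')
      rwa [if_pos hp] at this
    have hB'' : (B t' : ℝ) ≤ gridMax D L Q S A B := by exact_mod_cast hB'
    have h1 := (abs_le.1 (hB t' ht')).1
    rw [hintw] at h1
    have h2 := hnear (fun j => S * f (u j)) (fun j => (gridCoord Q t' j : ℝ)) 1 zero_le_one
      fun j hj => by
        have := hbt ⟨j, hj⟩
        simp only at this
        rw [this]
        exact hfl j
    have h3 : ∑ j ∈ Finset.range D, (S * f (u j)) • w j =
        (S : ℝ) • ∑ j ∈ Finset.range D, f (u j) • w j := by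
      simp [Finset.smul_sum, mul_smul]
    rw [h3, norm_smul, Real.norm_eq_abs, abs_of_pos hS'] at h2
    linarith

/-! ### Primitive recursiveness of the search -/

section Primrec

variable {γ : Type*} [Primcodable γ]

theorem Primrec.sum_range {n : γ → ℕ} {f : γ → ℕ → ℕ} (hn : Primrec n) (hf : Primrec₂ f) :
    Primrec fun g => ∑ i ∈ Finset.range (n g), f g i := by
  refine (Primrec.nat_rec' (h := fun g q => q.2 + f g q.1) hn (.const 0)
    (Primrec.nat_add.comp (Primrec.snd.comp Primrec.snd)
      (hf.comp Primrec.fst (Primrec.fst.comp Primrec.snd))).to₂).of_eq fun g => ?_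
  induction n g with
  | zero => rfl
  | succ k ih => rw [Finset.sum_range_succ, ← ih]

theorem Primrec.sup_range {n : γ → ℕ} {f : γ → ℕ → ℕ} (hn : Primrec n) (hf : Primrec₂ f) :
    Primrec fun g => (Finset.range (n g)).sup (f g) := by
  refine (Primrec.nat_rec' (h := fun g q => max (f g q.1) q.2) hn (.const 0)
    (Primrec.nat_max.comp (hf.comp Primrec.fst (Primrec.fst.comp Primrec.snd))
      (Primrec.snd.comp Primrec.snd)).to₂).of_eq fun g => ?_
  induction n g with
  | zero => rfl
  | succ k ih => rw [Finset.range_add_one, Finset.sup_insert, ← ih]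

theorem Primrec.nat_pow : Primrec₂ ((· ^ ·) : ℕ → ℕ → ℕ) :=
  Primrec₂.unpaired'.1 Nat.Primrec.pow

theorem PrimrecPred.forall_lt_comp {n : γ → ℕ} {R : ℕ → γ → Prop} (hn : Primrec n)
    (hR : PrimrecRel R) : PrimrecPred fun g => ∀ x < n g, R x g :=
  (hR.forall_mem_list.comp (Primrec.list_range.comp hn) .id).of_eq (by simp)

theorem Primrec.two_mul_add_one {L : γ → ℕ} (hL : Primrec L) : Primrec fun g => 2 * L g + 1 :=
  Primrec.succ.comp (Primrec.nat_mul.comp (.const 2) hL)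

theorem Primrec.digit {B t j : γ → ℕ} (hB : Primrec B) (ht : Primrec t) (hj : Primrec j) :
    Primrec fun g => t g / B g ^ j g % B g :=
  Primrec.nat_mod.comp (Primrec.nat_div.comp ht (Primrec.nat_pow.comp hB hj)) hB

theorem primrecPred_passesTests {D L Q S t' : γ → ℕ} {l : γ → List ℕ} (hD : Primrec D)
    (hL : Primrec L) (hQ : Primrec Q) (hS : Primrec S) (ht' : Primrec t') (hl : Primrec l) :
    PrimrecPred fun g =>
      PassesTests (D g) (L g) (Q g) (S g) (fun t => (l g).getD t 0) (t' g) := by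
  refine PrimrecPred.forall_lt_comp (Primrec.nat_pow.comp hL.two_mul_add_one hD) ?_
  have hg : Primrec fun p : (ℕ × γ) × ℕ => p.1.2 := Primrec.snd.comp Primrec.fst
  have d1 := Primrec.digit (hL.two_mul_add_one.comp hg) (Primrec.fst.comp Primrec.fst) Primrec.snd
  have d2 := Primrec.digit (hQ.two_mul_add_one.comp hg) (ht'.comp hg) Primrec.snd
  refine Primrec.nat_le.comp
    (Primrec.sum_range (hD.comp Primrec.snd) ?_)
    (Primrec.nat_add.comp (Primrec.sum_range (hD.comp Primrec.snd) ?_)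
      (Primrec.nat_add.comp
        (Primrec.nat_mul.comp (hS.comp Primrec.snd)
          (Primrec.nat_add.comp ((Primrec.list_getD 0).comp (hl.comp Primrec.snd) Primrec.fst)
            (.const 2)))
        (Primrec.nat_mul.comp (hD.comp Primrec.snd) (hL.comp Primrec.snd))))
  · exact Primrec.nat_add.comp (Primrec.nat_mul.comp d1 d2)
      (Primrec.nat_mul.comp (hL.comp hg) (hQ.comp hg))
  · exact Primrec.nat_add.comp (Primrec.nat_mul.comp d1 (hQ.comp hg))
      (Primrec.nat_mul.comp (hL.comp hg) d2)

/-- Tables enter as lists, making the search a function of finite data. Only entries at codes below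
(2L + 1)^D and (2Q + 1)^D are consulted, so with lists of these lengths the default 0 is never used.
-/
theorem primrec_gridMax {D L Q S : γ → ℕ} {lA lB : γ → List ℕ} (hD : Primrec D)
    (hL : Primrec L) (hQ : Primrec Q) (hS : Primrec S) (hlA : Primrec lA) (hlB : Primrec lB) :
    Primrec fun g => gridMax (D g) (L g) (Q g) (S g) (fun t => (lA g).getD t 0)
      (fun t => (lB g).getD t 0) := by
  refine Primrec.sup_range (Primrec.nat_pow.comp hQ.two_mul_add_one hD) ?_
  exact Primrec.ite
    (primrecPred_passesTests (hD.comp Primrec.fst) (hL.comp Primrec.fst) (hQ.comp Primrec.fst)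
      (hS.comp Primrec.fst) Primrec.snd (hlA.comp Primrec.fst))
    ((Primrec.list_getD 0).comp (hlB.comp Primrec.fst) Primrec.snd) (.const 0)

end Primrec

/-! ### Partial recursive tables, parameters and indices of scalars -/

/-- Tabulation of a partial recursive function on an initial segment. -/
theorem exists_partrec_table {α : Type*} [Primcodable α] {f : α × ℕ →. ℕ} (hf : Partrec f) :
    ∃ T : α × ℕ →. List ℕ, Partrec T ∧ ∀ (a : α) (n : ℕ) (v : ℕ → ℕ),
      (∀ t < n, v t ∈ f (a, t)) → (List.range n).map v ∈ T (a, n) := by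
  let step : α × ℕ → ℕ × List ℕ →. List ℕ :=
    fun p q => (f (p.1, q.1)).map fun c => q.2 ++ [c]
  have hstep : Partrec₂ step :=
    Partrec.map
      (hf.comp ((Computable.fst.comp Computable.fst).pair (Computable.fst.comp Computable.snd)))
      (Computable.list_concat.comp (Computable.snd.comp (Computable.snd.comp Computable.fst))
        Computable.snd).to₂
  refine ⟨_, Partrec.nat_rec Computable.snd (Computable.const []).partrec hstep,
    fun a n v hv => ?_⟩
  suffices h : ∀ m ≤ n, (List.range m).map v ∈ (Nat.rec (Part.some []) (fun y IH =>
      IH.bind fun i => step (a, n) (y, i)) m : Part (List ℕ)) from h n le_rfl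
  intro m
  induction m with
  | zero => exact fun _ => Part.mem_some _
  | succ m ih =>
    intro hm
    refine Part.mem_bind (ih (by omega)) ?_
    rw [List.range_succ, List.map_append]
    exact Part.mem_map _ (hv m (by omega))

theorem partrec₂_phi : Partrec₂ phi :=
  Nat.Partrec.Code.eval_part.comp ((Computable.ofNat _).comp Computable.fst) Computable.snd

/-- The parameter theorem for the enumeration `phi`. -/
theorem exists_computable_phi_eq {G : ℕ × ℕ →. ℕ} (hG : Partrec G) :
    ∃ s : ℕ → ℕ, Computable s ∧ ∀ e n, phi (s e) n = G (e, n) := by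
  have hG' : Nat.Partrec fun m : ℕ => G m.unpair := Partrec.nat_iff.1 (hG.comp Computable.unpair)
  obtain ⟨c, hc⟩ := Nat.Partrec.Code.exists_code.1 hG'
  refine ⟨fun e => Encodable.encode (c.curry e), Computable.encode.comp
    (Nat.Partrec.Code.primrec₂_curry.to_comp.comp (Computable.const c) Computable.id),
    fun e n => ?_⟩
  rw [phi, Denumerable.ofNat_encode, Nat.Partrec.Code.eval_curry, hc]
  simp only [Nat.unpair_pair]

/-- An index of the integer `a - b` as a computable real. -/
def realIndexSub (a b : ℕ) : ℕ :=
  Encodable.encode (Nat.Partrec.Code.const (Nat.pair (Nat.pair a b) 0))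

theorem computable_realIndexSub : Computable₂ realIndexSub :=
  Computable.encode.comp (Nat.Partrec.Code.primrec_const.to_comp.comp
    (Primrec₂.natPair.to_comp.comp (Primrec₂.natPair.to_comp.comp Computable.fst Computable.snd)
      (Computable.const 0)))

theorem isIndex_realIndexSub (a b : ℕ) :
    realNumbering.IsIndex (realIndexSub a b) ((a : ℝ) - b) := by
  refine ⟨fun _ => Nat.pair (Nat.pair a b) 0, fun n => ?_, fun n => ?_⟩
  · rw [phi, realIndexSub, Denumerable.ofNat_encode, Nat.Partrec.Code.eval_const]
    exact Part.mem_some _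
  · simp [ratNumbering]

/-- An index of the integer `a - b` as a computable scalar. -/
def scalarIndexSub (a b : ℕ) : ℕ := Nat.pair (realIndexSub a b) (realIndexSub 0 0)

theorem computable_scalarIndexSub : Computable₂ scalarIndexSub :=
  Primrec₂.natPair.to_comp.comp computable_realIndexSub (Computable.const _)

theorem isIndex_scalarIndexSub (𝕜 : Type*) [RCLike 𝕜] (a b : ℕ) :
    (scalarNumbering 𝕜).IsIndex (scalarIndexSub a b) ((a : 𝕜) - b) := by
  constructor
  · simpa [scalarIndexSub] using isIndex_realIndexSub a b
  · simpa [scalarIndexSub] using isIndex_realIndexSub 0 0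

/-- The index depends on whether 𝕜 is real, where I = 0, or complex; existence of one fixed number
is enough. -/
theorem exists_isIndex_I (𝕜 : Type*) [RCLike 𝕜] :
    ∃ e, (scalarNumbering 𝕜).IsIndex e RCLike.I := by
  rcases RCLike.I_eq_zero_or_im_I_eq_one (K := 𝕜) with h | h
  · exact ⟨scalarIndexSub 0 0, by simpa [h] using isIndex_scalarIndexSub 𝕜 0 0⟩
  · refine ⟨Nat.pair (realIndexSub 0 0) (realIndexSub 1 0), ?_, ?_⟩
    · simpa using isIndex_realIndexSub 0 0
    · simpa [h] using isIndex_realIndexSub 1 0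

theorem exists_isIndex_neg_I (𝕜 : Type*) [RCLike 𝕜] :
    ∃ e, (scalarNumbering 𝕜).IsIndex e (-RCLike.I) := by
  rcases RCLike.I_eq_zero_or_im_I_eq_one (K := 𝕜) with h | h
  · exact ⟨scalarIndexSub 0 0, by simpa [h] using isIndex_scalarIndexSub 𝕜 0 0⟩
  · refine ⟨Nat.pair (realIndexSub 0 0) (realIndexSub 0 1), ?_, ?_⟩
    · simpa using isIndex_realIndexSub 0 0
    · simpa [h] using isIndex_realIndexSub 0 1

/-- Alternating scalars `1, z, 1, z, …` have computable indices if `z` has an index. -/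
theorem exists_computable_isIndex_alternating {𝕜 : Type*} [RCLike 𝕜] {z : 𝕜} {e : ℕ}
    (he : (scalarNumbering 𝕜).IsIndex e z) : ∃ g : ℕ → ℕ, Computable g ∧
      ∀ j, (scalarNumbering 𝕜).IsIndex (g j) (if j % 2 = 0 then 1 else z) := by
  refine ⟨fun j => if j % 2 = 0 then scalarIndexSub 1 0 else e, Primrec.to_comp (Primrec.ite
    (Primrec.eq.comp (Primrec.nat_mod.comp .id (.const 2)) (.const 0)) (.const _) (.const _)),
    fun j => ?_⟩
  by_cases hj : j % 2 = 0
  · simpa [hj] using isIndex_scalarIndexSub 𝕜 1 0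
  · simpa [hj] using he

/-! ### Approximate norms of integer combinations in an effective space -/

section EffectiveSpace

variable {𝕜 : Type*} [RCLike 𝕜] {X : Type*} [NormedAddCommGroup X] [NormedSpace 𝕜 X]
  {ν : PartialNumbering X}

/-- Norms can be computed uniformly up to a bounded error. -/
theorem IsEffectiveSpace.exists_partrec_norm (hν : IsEffectiveSpace 𝕜 ν) :
    ∃ N : ℕ →. ℕ, Partrec N ∧ ∀ e x, ν.IsIndex e x → ∃ A ∈ N e, |(A : ℝ) - ‖x‖| ≤ 2 := by
  obtain ⟨φ, hφ, h⟩ := hν.norm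
  -- The rational at precision 2⁰ is off by less than 1, and integer division by at most 1 more. If
  -- the rational is negative, the norm is below 1 and truncated subtraction returns 0.
  refine ⟨fun e => (φ e).bind fun c => (phi c 0).map fun r =>
    (r.unpair.1.unpair.1 - r.unpair.1.unpair.2) / (r.unpair.2 + 1),
    (Partrec.nat_iff.2 hφ).bind (Partrec.map
      (partrec₂_phi.comp Computable.snd (Computable.const 0)) (Primrec.to_comp ?_)),
    fun e x hx => ?_⟩
  · have h1 : Primrec fun p : (ℕ × ℕ) × ℕ => p.2.unpair := Primrec.unpair.comp Primrec.snd
    have h2 := Primrec.unpair.comp (Primrec.fst.comp h1)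
    exact Primrec.nat_div.comp (Primrec.nat_sub.comp (Primrec.fst.comp h2) (Primrec.snd.comp h2))
      (Primrec.succ.comp (Primrec.snd.comp h1))
  · obtain ⟨c, hc, f, hf, hconv⟩ := h e x hx
    refine ⟨_, Part.mem_bind hc (Part.mem_map _ (hf 0)), ?_⟩
    have h0 := hconv 0
    rw [pow_zero, Real.norm_eq_abs, abs_lt] at h0
    simp only [ratNumbering] at h0
    push_cast at h0
    generalize f 0 = r at h0 ⊢
    generalize r.unpair.1.unpair.1 = a, r.unpair.1.unpair.2 = b, r.unpair.2 = d at h0 ⊢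
    have hd : (0 : ℝ) < d + 1 := by positivity
    have h1 : (((a - b) / (d + 1) : ℕ) : ℝ) ≤ ((a - b : ℕ) : ℝ) / (d + 1) := by
      exact_mod_cast Nat.cast_div_le (α := ℝ) (m := a - b) (n := d + 1)
    have h2 : ((a - b : ℕ) : ℝ) / (d + 1) ≤ (((a - b) / (d + 1) : ℕ) : ℝ) + 1 := by
      rw [div_le_iff₀ hd]
      have := (Nat.lt_div_mul_add (a := a - b) (Nat.succ_pos d)).le
      have h3 : a - b ≤ ((a - b) / (d + 1) + 1) * (d + 1) := by
        rw [add_mul, one_mul]; exact this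
      exact_mod_cast h3
    rw [abs_le]
    rcases le_total b a with hab | hab
    · rw [Nat.cast_sub hab] at h1 h2
      constructor <;> linarith
    · have h3 : ((a : ℝ) - b) / (d + 1) ≤ 0 :=
        div_nonpos_of_nonpos_of_nonneg (sub_nonpos.2 (by exact_mod_cast hab)) hd.le
      rw [Nat.sub_eq_zero_of_le hab, Nat.zero_div, Nat.cast_zero]
      have := norm_nonneg x
      constructor <;> linarith

/-- Multiplication by computable scalars, on indices given by partial recursive functions. -/
theorem IsEffectiveSpace.exists_partrec_smul (hν : IsEffectiveSpace 𝕜 ν) {α : Type*}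
    [Primcodable α] {U : α →. ℕ} (hU : Partrec U) {s : α → ℕ} (hs : Computable s) :
    ∃ V : α →. ℕ, Partrec V ∧ ∀ (a : α) (z : 𝕜) (x : X), (scalarNumbering 𝕜).IsIndex (s a) z →
      (∃ c ∈ U a, ν.IsIndex c x) → ∃ c ∈ V a, ν.IsIndex c (z • x) := by
  obtain ⟨φ, hφ, h⟩ := hν.smul
  refine ⟨fun a => (U a).bind fun c => φ (Nat.pair (s a) c), hU.bind
    ((Partrec.nat_iff.2 hφ).comp (Primrec₂.natPair.to_comp.comp (hs.comp Computable.fst)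
      Computable.snd)), fun a z x hz ⟨c, hc, hx⟩ => ?_⟩
  obtain ⟨k, hk, hk'⟩ := h (Nat.pair (s a) c) (z, x) (by constructor <;> simpa)
  exact ⟨k, Part.mem_bind hc hk, hk'⟩

/-- Finite sums of integral multiples are effective. -/
theorem IsEffectiveSpace.exists_partrec_sum (hν : IsEffectiveSpace 𝕜 ν) {α : Type*}
    [Primcodable α] {U : α × ℕ →. ℕ} (hU : Partrec U) {p q : α × ℕ → ℕ} (hp : Computable p)
    (hq : Computable q) :
    ∃ V : α × ℕ →. ℕ, Partrec V ∧ ∀ (a : α) (u : ℕ → X),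
      (∀ j, ∃ c ∈ U (a, j), ν.IsIndex c (u j)) → ∀ D, ∃ c ∈ V (a, D),
        ν.IsIndex c (∑ j ∈ Finset.range D, ((p (a, j) : ℤ) - q (a, j)) • u j) := by
  obtain ⟨W, hW, hWu⟩ := hν.exists_partrec_smul hU (computable_scalarIndexSub.comp hp hq)
  -- The axioms supply no index of the zero vector; the empty sum is obtained as 0 • u_0.
  obtain ⟨Z, hZ, hZu⟩ := hν.exists_partrec_smul
    (hU.comp ((Computable.fst (α := α) (β := ℕ)).pair (Computable.const 0)))
    (Computable.const (scalarIndexSub 0 0))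
  obtain ⟨φ, hφ, h⟩ := hν.add
  let step : α × ℕ → ℕ × ℕ →. ℕ := fun a r => (W (a.1, r.1)).bind fun c => φ (Nat.pair r.2 c)
  have hstep : Partrec₂ step :=
    Partrec.bind
      (hW.comp ((Computable.fst.comp Computable.fst).pair (Computable.fst.comp Computable.snd)))
      ((Partrec.nat_iff.2 hφ).comp (Primrec₂.natPair.to_comp.comp
        (Computable.snd.comp (Computable.snd.comp Computable.fst)) Computable.snd))
  refine ⟨_, Partrec.nat_rec Computable.snd hZ hstep, fun a u hu D => ?_⟩
  suffices H : ∀ m, ∃ c ∈ (Nat.rec (Z (a, D)) (fun y IH => IH.bind fun i => step (a, D) (y, i)) m :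
      Part ℕ), ν.IsIndex c (∑ j ∈ Finset.range m, ((p (a, j) : ℤ) - q (a, j)) • u j) from H D
  intro m
  induction m with
  | zero => simpa using hZu (a, D) 0 (u 0) (by simpa using isIndex_scalarIndexSub 𝕜 0 0) (hu 0)
  | succ m ih =>
    obtain ⟨c, hc, hc'⟩ := ih
    obtain ⟨k, hk, hk'⟩ := hWu (a, m) _ (u m) (isIndex_scalarIndexSub 𝕜 _ _) (hu m)
    obtain ⟨r, hr, hr'⟩ := h (Nat.pair c k) (_, _) ⟨by simpa using hc', by simpa using hk'⟩
    refine ⟨r, Part.mem_bind hc (Part.mem_bind hk hr), ?_⟩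
    rw [Finset.sum_range_succ, ← Int.cast_smul_eq_zsmul 𝕜 _ (u m)]
    simpa using hr'

/-- Approximate norms of all integer combinations with bounded coefficients can be tabulated. -/
theorem IsEffectiveSpace.exists_partrec_gridNorm (hν : IsEffectiveSpace 𝕜 ν) {s : ℕ → 𝕜}
    {g : ℕ → ℕ} (hg : Computable g) (hgs : ∀ j, (scalarNumbering 𝕜).IsIndex (g j) (s j)) :
    ∃ T : (ℕ × ℕ) × (ℕ × ℕ) →. List ℕ, Partrec T ∧ ∀ (a : ℕ) (x : ℕ → ℕ → X),
      ν.seq₂.IsIndex a x → ∀ n D L, ∃ l ∈ T ((a, n), (D, L)), ∀ t < (2 * L + 1) ^ D,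
        |(l.getD t 0 : ℝ) - ‖∑ j ∈ Finset.range D, gridCoord L t j • s j • x (j / 2) n‖| ≤ 2 := by
  let α := ((ℕ × ℕ) × (ℕ × ℕ)) × ℕ
  have hU : Partrec fun r : α × ℕ => phi r.1.1.1.1 (Nat.pair (r.2 / 2) r.1.1.1.2) := by
    have h1 : Computable fun r : α × ℕ => r.1.1.1 :=
      Computable.fst.comp (Computable.fst.comp Computable.fst)
    exact partrec₂_phi.comp (Computable.fst.comp h1) (Primrec₂.natPair.to_comp.comp
      (Primrec.nat_div.to_comp.comp Computable.snd (Computable.const 2)) (Computable.snd.comp h1))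
  obtain ⟨U, hU, hUx⟩ := hν.exists_partrec_smul hU (hg.comp Computable.snd)
  have hL : Primrec fun r : α × ℕ => r.1.1.2.2 :=
    Primrec.snd.comp (Primrec.snd.comp (Primrec.fst.comp Primrec.fst))
  obtain ⟨V, hV, hVx⟩ := hν.exists_partrec_sum hU
    (Primrec.digit hL.two_mul_add_one (Primrec.snd.comp Primrec.fst) Primrec.snd).to_comp
    hL.to_comp
  obtain ⟨N, hN, hNx⟩ := hν.exists_partrec_norm
  have hD : Computable fun r : α => r.1.2.1 :=
    Computable.fst.comp (Computable.snd.comp Computable.fst)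
  obtain ⟨T, hT, hTx⟩ := exists_partrec_table (f := fun r : α => (V (r, r.1.2.1)).bind N)
    ((hV.comp (Computable.id.pair hD)).bind (hN.comp Computable.snd))
  have hB : Primrec fun r : (ℕ × ℕ) × (ℕ × ℕ) => (2 * r.2.2 + 1) ^ r.2.1 :=
    Primrec.nat_pow.comp (Primrec.two_mul_add_one (Primrec.snd.comp Primrec.snd))
      (Primrec.fst.comp Primrec.snd)
  refine ⟨_, hT.comp (Computable.id.pair hB.to_comp), fun a x hx n D L => ?_⟩
  have key : ∀ t, ∃ A ∈ (V ((((a, n), (D, L)), t), D)).bind N,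
      |(A : ℝ) - ‖∑ j ∈ Finset.range D, gridCoord L t j • s j • x (j / 2) n‖| ≤ 2 := fun t => by
    obtain ⟨c, hc, hc'⟩ := hVx (((a, n), (D, L)), t) (fun j => s j • x (j / 2) n)
      (fun j => hUx ((((a, n), (D, L)), t), j) (s j) _ (hgs j) (hx (j / 2) n)) D
    obtain ⟨A, hA, hA'⟩ := hNx c _ hc'
    exact ⟨A, Part.mem_bind hc hA, hA'⟩
  choose A hA hA' using key
  refine ⟨_, hTx ((a, n), (D, L)) ((2 * L + 1) ^ D) A fun t _ => hA t, fun t ht => ?_⟩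
  rw [List.getD_eq_getElem _ _ (by simpa using ht)]
  simpa using hA' t

/-- Sums of norms can be bounded effectively. -/
theorem IsEffectiveSpace.exists_partrec_sum_norm_le (hν : IsEffectiveSpace 𝕜 ν) {s : ℕ → 𝕜}
    {g : ℕ → ℕ} (hg : Computable g) (hgs : ∀ j, (scalarNumbering 𝕜).IsIndex (g j) (s j)) :
    ∃ R : (ℕ × ℕ) × ℕ →. ℕ, Partrec R ∧ ∀ (a : ℕ) (x : ℕ → ℕ → X), ν.seq₂.IsIndex a x →
      ∀ n D, ∃ r ∈ R ((a, n), D), ∑ j ∈ Finset.range D, ‖s j • x (j / 2) n‖ ≤ r := by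
  obtain ⟨T, hT, hTx⟩ := hν.exists_partrec_gridNorm hg hgs
  have hf : Primrec fun p : ((ℕ × ℕ) × ℕ) × List ℕ =>
      p.1.2 * (∑ t ∈ Finset.range ((2 * 1 + 1) ^ p.1.2), p.2.getD t 0 + 2) := by
    have h1 : Primrec fun p : ((ℕ × ℕ) × ℕ) × List ℕ => p.1.2 := Primrec.snd.comp Primrec.fst
    exact Primrec.nat_mul.comp h1 (Primrec.nat_add.comp (Primrec.sum_range
      (Primrec.nat_pow.comp (.const _) h1)
      ((Primrec.list_getD 0).comp (Primrec.snd.comp Primrec.fst) Primrec.snd)) (.const 2))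
  refine ⟨_, Partrec.map (hT.comp (Computable.fst.pair (Computable.snd.pair (Computable.const 1))))
    (hf.to_comp.to₂), fun a x hx n D => ?_⟩
  obtain ⟨l, hl, hl'⟩ := hTx a x hx n D 1
  refine ⟨_, Part.mem_map _ hl, ?_⟩
  have h : ∀ j ∈ Finset.range D, ‖s j • x (j / 2) n‖ ≤
      ((∑ t ∈ Finset.range ((2 * 1 + 1) ^ D), l.getD t 0 + 2 : ℕ) : ℝ) := fun j hj => by
    -- The grid with L = 1 contains the unit vector e_j, so the table has an entry within 2 of
    -- ‖u_j‖, and the sum of all entries dominates it.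
    obtain ⟨t, ht, htj⟩ := exists_gridCoord_eq (L := 1)
      (Pi.single ⟨j, Finset.mem_range.1 hj⟩ 1 : Fin D → ℤ) fun i => by
        by_cases hi : i = ⟨j, Finset.mem_range.1 hj⟩
        · subst hi; simp
        · simp [hi]
    have h1 := (abs_le.1 (hl' t ht)).1
    rw [Finset.sum_range, Finset.sum_eq_single ⟨j, Finset.mem_range.1 hj⟩, htj] at h1
    · simp only [Pi.single_eq_same, one_smul] at h1
      have h2 : l.getD t 0 ≤ ∑ t ∈ Finset.range ((2 * 1 + 1) ^ D), l.getD t 0 :=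
        Finset.single_le_sum (f := fun t => l.getD t 0) (fun _ _ => Nat.zero_le _)
          (Finset.mem_range.2 ht)
      have h3 : (l.getD t 0 : ℝ) ≤ (∑ t ∈ Finset.range ((2 * 1 + 1) ^ D), l.getD t 0 : ℕ) := by
        exact_mod_cast h2
      push_cast at h3 ⊢
      linarith
    · intro i _ hi
      rw [htj, Pi.single_eq_of_ne hi, zero_smul]
    · simp
  refine (Finset.sum_le_sum h).trans (le_of_eq ?_)
  rw [Finset.sum_const, Finset.card_range, nsmul_eq_mul, Nat.cast_mul]

end EffectiveSpace

/-! ### Choice of scale and computation of the norm -/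

/-- The scale at which the norm of an operator is approximated with error `2⁻¹ ^ (k + 1)`. -/
def gridScale (k D R : ℕ) : ℕ := 2 ^ (k + 1) * ((D + 1) * R + 3)

/-- The bound on the coefficients of approximate values of functionals. -/
def gridRadius (k D R : ℕ) : ℕ := gridScale k D R * R + 1

/-- The bound on the coefficients of test vectors. -/
def testRadius (k D R : ℕ) : ℕ := gridScale k D R * (R + 4) + D * gridRadius k D R + 1

section Primrec

variable {γ : Type*} [Primcodable γ] {k D R : γ → ℕ}

theorem primrec_gridScale (hk : Primrec k) (hD : Primrec D) (hR : Primrec R) :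
    Primrec fun g => gridScale (k g) (D g) (R g) :=
  Primrec.nat_mul.comp (Primrec.nat_pow.comp (.const 2) (Primrec.succ.comp hk))
    (Primrec.nat_add.comp (Primrec.nat_mul.comp (Primrec.succ.comp hD) hR) (.const 3))

theorem primrec_gridRadius (hk : Primrec k) (hD : Primrec D) (hR : Primrec R) :
    Primrec fun g => gridRadius (k g) (D g) (R g) :=
  Primrec.succ.comp (Primrec.nat_mul.comp (primrec_gridScale hk hD hR) hR)

theorem primrec_testRadius (hk : Primrec k) (hD : Primrec D) (hR : Primrec R) :
    Primrec fun g => testRadius (k g) (D g) (R g) :=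
  Primrec.succ.comp (Primrec.nat_add.comp
    (Primrec.nat_mul.comp (primrec_gridScale hk hD hR) (Primrec.nat_add.comp hR (.const 4)))
    (Primrec.nat_mul.comp hD (primrec_gridRadius hk hD hR)))

end Primrec

theorem gridScale_pos (k D R : ℕ) : 0 < gridScale k D R := by
  unfold gridScale
  positivity

/-- The scale is 2 ^ (k + 1) times a number exceeding the error (D + 1) R + 2 by one, hence the
strict inequality. -/
theorem abs_div_gridScale_sub_lt {k D R g : ℕ} {V : ℝ}
    (h : |(g : ℝ) - gridScale k D R * V| ≤ (D + 1) * R + 2) :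
    |(g : ℝ) / gridScale k D R - V| < (2 : ℝ)⁻¹ ^ (k + 1) := by
  have hS : (0 : ℝ) < gridScale k D R := by exact_mod_cast gridScale_pos k D R
  have h1 : (g : ℝ) / gridScale k D R - V = (g - gridScale k D R * V) / gridScale k D R := by
    field_simp
  rw [h1, abs_div, abs_of_pos hS, div_lt_iff₀ hS]
  refine h.trans_lt ?_
  rw [gridScale]
  push_cast
  rw [inv_pow, inv_mul_cancel_left₀ (by positivity)]
  linarith

theorem ratNumbering_pair_pred {a S : ℕ} (hS : 0 < S) :
    (ratNumbering (Nat.pair (Nat.pair a 0) (S - 1)) : ℝ) = a / S := by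
  simp only [ratNumbering, Nat.unpair_pair, Nat.cast_zero, sub_zero, Nat.cast_pred hS,
    sub_add_cancel]
  push_cast
  rfl

/-- The norms of the operators `∑_{i < d} x_{i,n} ⊙ y_{i,n}` can be computed uniformly. -/
theorem exists_partrec_norm_sum_odot {𝕜 : Type*} [RCLike 𝕜] {X : Type*} [NormedAddCommGroup X]
    [NormedSpace 𝕜 X] {ν : PartialNumbering X} (hν : IsEffectiveSpace 𝕜 ν)
    {ν' : PartialNumbering (StrongDual 𝕜 X)} (hν' : IsEffectiveSpace 𝕜 ν') :
    ∃ G : ((ℕ × ℕ) × ℕ) × (ℕ × ℕ) →. ℕ, Partrec G ∧ ∀ (a b : ℕ) (x : ℕ → ℕ → X)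
      (y : ℕ → ℕ → StrongDual 𝕜 X), ν.seq₂.IsIndex a x → ν'.seq₂.IsIndex b y → ∀ k n d,
        ∃ c ∈ G (((a, b), k), (n, d)),
          |(ratNumbering c : ℝ) - ‖∑ i ∈ Finset.range d, odot (x i n) (y i n)‖| <
            (2 : ℝ)⁻¹ ^ (k + 1) := by
  obtain ⟨eI, heI⟩ := exists_isIndex_I 𝕜
  obtain ⟨eJ, heJ⟩ := exists_isIndex_neg_I 𝕜
  obtain ⟨g, hg, hgs⟩ := exists_computable_isIndex_alternating heI
  obtain ⟨g', hg', hgs'⟩ := exists_computable_isIndex_alternating heJ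
  obtain ⟨T, hT, hTx⟩ := hν.exists_partrec_gridNorm (s := unitOrI 𝕜) hg hgs
  obtain ⟨T', hT', hTy⟩ := hν'.exists_partrec_gridNorm (s := unitOrNegI 𝕜) hg' hgs'
  obtain ⟨R, hR, hRx⟩ := hν.exists_partrec_sum_norm_le (s := unitOrI 𝕜) hg hgs
  obtain ⟨R', hR', hRy⟩ := hν'.exists_partrec_sum_norm_le (s := unitOrNegI 𝕜) hg' hgs'
  let α := ((ℕ × ℕ) × ℕ) × (ℕ × ℕ)
  have ha : Primrec fun r : α => (r.1.1.1, r.2.1) :=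
    (Primrec.fst.comp (Primrec.fst.comp Primrec.fst)).pair (Primrec.fst.comp Primrec.snd)
  have hb : Primrec fun r : α => (r.1.1.2, r.2.1) :=
    (Primrec.snd.comp (Primrec.fst.comp Primrec.fst)).pair (Primrec.fst.comp Primrec.snd)
  have hk : Primrec fun r : α => r.1.2 := Primrec.snd.comp Primrec.fst
  have hD : Primrec fun r : α => 2 * r.2.2 :=
    Primrec.nat_mul.comp (.const 2) (Primrec.snd.comp Primrec.snd)
  -- The sum of the two bounds serves as the common R for the vectors and the functionals.
  have hB : ∃ B : α →. ℕ, Partrec B ∧ ∀ r : α, ∀ c ∈ R ((r.1.1.1, r.2.1), 2 * r.2.2),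
      ∀ c' ∈ R' ((r.1.1.2, r.2.1), 2 * r.2.2), c + c' ∈ B r :=
    ⟨fun r => (R ((r.1.1.1, r.2.1), 2 * r.2.2)).bind fun c =>
      (R' ((r.1.1.2, r.2.1), 2 * r.2.2)).map fun c' => c + c',
      Partrec.bind (hR.comp (ha.pair hD).to_comp)
        (Partrec.map (hR'.comp ((hb.pair hD).to_comp.comp Computable.fst))
          (Primrec.nat_add.comp (Primrec.snd.comp Primrec.fst) Primrec.snd).to_comp),
      fun r c hc c' hc' => Part.mem_bind hc (Part.mem_map _ hc')⟩
  obtain ⟨B, hB, hBr⟩ := hB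
  have hk₁ : Primrec fun r : α × ℕ => r.1.1.2 := hk.comp Primrec.fst
  have hD₁ : Primrec fun r : α × ℕ => 2 * r.1.2.2 := hD.comp Primrec.fst
  have hS := primrec_gridScale hk₁ hD₁ Primrec.snd
  have hQ := primrec_gridRadius hk₁ hD₁ Primrec.snd
  have hL := primrec_testRadius hk₁ hD₁ Primrec.snd
  let out : (α × ℕ) → List ℕ × List ℕ → ℕ := fun r l =>
    Nat.pair (Nat.pair (gridMax (2 * r.1.2.2) (testRadius r.1.1.2 (2 * r.1.2.2) r.2)
      (gridRadius r.1.1.2 (2 * r.1.2.2) r.2) (gridScale r.1.1.2 (2 * r.1.2.2) r.2)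
      (fun t => l.1.getD t 0) (fun t => l.2.getD t 0)) 0) (gridScale r.1.1.2 (2 * r.1.2.2) r.2 - 1)
  have hout : Primrec₂ out :=
    Primrec₂.natPair.comp (Primrec₂.natPair.comp
      (primrec_gridMax (hD₁.comp Primrec.fst) (hL.comp Primrec.fst) (hQ.comp Primrec.fst)
        (hS.comp Primrec.fst) (Primrec.fst.comp Primrec.snd) (Primrec.snd.comp Primrec.snd))
      (.const 0)) (Primrec.pred.comp (hS.comp Primrec.fst))
  let G₁ : α × ℕ →. ℕ := fun r =>
    (T ((r.1.1.1.1, r.1.2.1), (2 * r.1.2.2, testRadius r.1.1.2 (2 * r.1.2.2) r.2))).bind fun l =>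
      (T' ((r.1.1.1.2, r.1.2.1), (2 * r.1.2.2, gridRadius r.1.1.2 (2 * r.1.2.2) r.2))).map
        fun l' => out r (l, l')
  have hG₁ : Partrec G₁ :=
    Partrec.bind (hT.comp ((ha.comp Primrec.fst).pair (hD₁.pair hL)).to_comp)
      (Partrec.map (hT'.comp (((hb.comp Primrec.fst).pair (hD₁.pair hQ)).to_comp.comp
          Computable.fst))
        (hout.comp (Primrec.fst.comp Primrec.fst)
          ((Primrec.snd.comp Primrec.fst).pair Primrec.snd)).to_comp)
  refine ⟨fun r => (B r).bind fun c => G₁ (r, c), hB.bind hG₁, fun a b x y hx hy k n d => ?_⟩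
  obtain ⟨c, hc, hcx⟩ := hRx a x hx n (2 * d)
  obtain ⟨c', hc', hcy⟩ := hRy b y hy n (2 * d)
  have hcc := hBr (((a, b), k), (n, d)) c hc c' hc'
  obtain ⟨l, hl, hlx⟩ := hTx a x hx n (2 * d) (testRadius k (2 * d) (c + c'))
  obtain ⟨l', hl', hly⟩ := hTy b y hy n (2 * d) (gridRadius k (2 * d) (c + c'))
  refine ⟨_, Part.mem_bind hcc (Part.mem_bind hl (Part.mem_map _ hl')), ?_⟩
  rw [ratNumbering_pair_pred (gridScale_pos _ _ _)]
  let : NormedSpace ℝ X := NormedSpace.restrictScalars ℝ 𝕜 X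
  have : IsScalarTower ℝ 𝕜 X := RestrictScalars.isScalarTower ℝ 𝕜 X
  refine abs_div_gridScale_sub_lt (abs_gridMax_sub_le (u := fun j => unitOrI 𝕜 j • x (j / 2) n)
    (w := fun j => unitOrNegI 𝕜 j • y (j / 2) n) rfl rfl
    (hcx.trans (by push_cast; linarith [c'.cast_nonneg (α := ℝ)]))
    (hcy.trans (by push_cast; linarith [c.cast_nonneg (α := ℝ)])) hlx hly
    (fun f => norm_sum_real_functional_smul_le f (fun i => x i n) (fun i => y i n) d)
    (fun M hM => norm_sum_odot_le (fun i => x i n) (fun i => y i n) d hM) (norm_nonneg _)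
    (gridScale_pos _ _ _))

theorem theorem53 {𝕜 : Type*} [RCLike 𝕜] {X : Type*} [NormedAddCommGroup X] [NormedSpace 𝕜 X]
    [CompleteSpace X] (hAP : HasApproximationProperty 𝕜 X)
    (ν : PartialNumbering X) (hν : IsEffectiveSpace 𝕜 ν)
    (ν' : PartialNumbering (StrongDual 𝕜 X)) (hν' : IsEffectiveSpace 𝕜 ν') :
    EffectiveOp (effectivelyCompactNumbering ν ν') realNumbering (fun T => ‖T‖) := by
  obtain ⟨G, hG, hGx⟩ := exists_partrec_norm_sum_odot hν hν'
  have h₂ : Primrec fun p : ℕ × ℕ => p.1.unpair.2 := Primrec.snd.comp (Primrec.unpair.comp .fst)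
  have h₂' : Primrec fun p : ℕ × ℕ => p.1.unpair.2.unpair := Primrec.unpair.comp h₂
  have h₃ : Primrec fun p : ℕ × ℕ => p.1.unpair.2.unpair.2.unpair :=
    Primrec.unpair.comp (Primrec.snd.comp h₂')
  have hab : Primrec fun p : ℕ × ℕ => ((p.1.unpair.1, p.1.unpair.2.unpair.1), p.2) :=
    ((Primrec.fst.comp (Primrec.unpair.comp .fst)).pair (Primrec.fst.comp h₂')).pair .snd
  -- At precision k the approximant at stage m(k + 1) is used: half of 2⁻ᵏ pays for replacing T by
  -- it and half for computing its norm.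
  let F : ℕ × ℕ →. ℕ := fun p =>
    (phi p.1.unpair.2.unpair.2.unpair.2 (p.2 + 1)).bind fun n =>
      (phi p.1.unpair.2.unpair.2.unpair.1 n).bind fun d =>
        G (((p.1.unpair.1, p.1.unpair.2.unpair.1), p.2), (n, d))
  have hF : Partrec F :=
    Partrec.bind (partrec₂_phi.comp (Primrec.snd.comp h₃).to_comp
        (Primrec.succ.comp Primrec.snd).to_comp)
      (Partrec.bind (partrec₂_phi.comp ((Primrec.fst.comp h₃).to_comp.comp Computable.fst)
          Computable.snd)
        (hG.comp ((hab.to_comp.comp (Computable.fst.comp Computable.fst)).pair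
          ((Computable.snd.comp Computable.fst).pair Computable.snd))))
  obtain ⟨s, hs, hsF⟩ := exists_computable_phi_eq hF
  refine ⟨fun e => Part.some (s e), Partrec.nat_iff.1 hs, ?_⟩
  rintro e T ⟨x, y, d, m, hx, hy, hd, hm, hT⟩
  refine ⟨s e, Part.mem_some _, ?_⟩
  have key : ∀ k, ∃ c ∈ phi (s e) k, |(ratNumbering c : ℝ) - ‖T‖| < (2 : ℝ)⁻¹ ^ k := fun k => by
    obtain ⟨c, hc, hc'⟩ := hGx _ _ x y hx hy k (m (k + 1)) (d (m (k + 1)))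
    refine ⟨c, ?_, ?_⟩
    · rw [hsF]
      exact Part.mem_bind (hm (k + 1)) (Part.mem_bind (hd _) hc)
    · have h1 := (abs_norm_sub_norm_le _ _).trans_lt (hT (k + 1) _ le_rfl)
      refine (abs_sub_le _ _ _).trans_lt ((add_lt_add hc' h1).trans_eq ?_)
      rw [pow_succ]
      ring
  choose f hf hfT using key
  exact ⟨f, hf, hfT⟩
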